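/- Let $K$ be an algebraically closed field and let $n, m$ be positive integers. The group $\mathrm{GL}_n(K)$ acts on the affine space $(K^{n\times n})^m$ of $m$-tuples of $n\times n$ matrices by simultaneous conjugation, $g\cdot(A_1,\dots,A_m)=(gA_1g^{-1},\dots,gA_mg^{-1})$; write $\mathcal{O}(A)$ for the orbit of $A$, and $\dim\mathcal{O}(A)$ for its dimension as a locally closed subset of $(K^{n\times n})^m$, i.e. its Krull dimension in the Zariski topology. Let $R=K\langle x_1,\dots,x_m\rangle$ be the free associative unital $K$-algebra. For $\varphi=(\varphi_{ij})\in R^{k\times l}$ let $\varphi(A)\in K^{kn\times ln}$ be the block matrix whose $(i,j)$ block is the $n\times n$ matrix $\varphi_{ij}(A)$. Write $A\le_{\mathrm{hom}}B$ if $\mathrm{rk}\,\varphi(A)\ge \mathrm{rk}\,\varphi(B)$ for all $k,l$ and all $\varphi\in R^{k\times l}$, and write $A<_{\mathrm{hom}}B$ if $A\le_{\mathrm{hom}}B$ and $\mathcal{O}(A)\ne\mathcal{O}(B)$. Let $A,B\in (K^{n\times n})^m$. If $A<_{\mathrm{hom}}B$, then $\dim\mathcal{O}(A)>\dim\mathcal{O}(B)$.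 -/

import Mathlib

noncomputable section

/-- The Zariski topology on the affine space `K ^ σ`: the closed sets are the common zero loci
of ideals of polynomials with coefficients in `K`. -/
@[reducible] def zariskiTopology (K σ : Type*) [Field K] : TopologicalSpace (σ → K) :=
  TopologicalSpace.ofClosed
    {Z : Set (σ → K) | ∃ I : Ideal (MvPolynomial σ K), Z = MvPolynomial.zeroLocus K I}
    ⟨⊤, by simp⟩
    (by
      intro S hS
      refine ⟨sSup {I : Ideal (MvPolynomial σ K) | MvPolynomial.zeroLocus K I ∈ S}, ?_⟩
      ext x
      constructor
      · intro hx
        have h : sSup {I : Ideal (MvPolynomial σ K) | MvPolynomial.zeroLocus K I ∈ S} ≤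
            MvPolynomial.vanishingIdeal K {x} := by
          refine sSup_le fun I hI p hp y hy => ?_
          rw [Set.mem_singleton_iff.1 hy]
          exact hx _ hI p hp
        exact fun p hp => h hp x rfl
      · intro hx Z hZ
        obtain ⟨I, rfl⟩ := hS hZ
        exact MvPolynomial.zeroLocus_anti_mono (le_sSup hZ) hx)
    (by
      rintro _ ⟨I, rfl⟩ _ ⟨J, rfl⟩
      refine ⟨I * J, ?_⟩
      ext x
      constructor
      · rintro (hx | hx)
        · exact MvPolynomial.zeroLocus_anti_mono Ideal.mul_le_left hx
        · exact MvPolynomial.zeroLocus_anti_mono Ideal.mul_le_right hx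
      · intro hx
        by_contra h
        simp only [Set.mem_union, MvPolynomial.mem_zeroLocus_iff, not_or, not_forall] at h
        obtain ⟨⟨p, hp, hpx⟩, ⟨q, hq, hqx⟩⟩ := h
        have := hx (p * q) (Ideal.mul_mem_mul hp hq)
        rw [map_mul] at this
        exact (mul_ne_zero hpx hqx) this)

/-- The space `(K ^ (n × n)) ^ m` of `m`-tuples of `n × n` matrices over `K`. -/
abbrev MatTuple (K : Type*) (n m : ℕ) : Type _ := Fin m → Matrix (Fin n) (Fin n) K

namespace MatTuple

variable {K : Type*} [Field K] {n m : ℕ}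

/-- The `m * n * n` matrix entries of a tuple, as a point of affine space. -/
def coords (A : MatTuple K n m) : Fin m × Fin n × Fin n → K :=
  fun p => A p.1 p.2.1 p.2.2

/-- The Zariski topology on `(K ^ (n × n)) ^ m`, viewed as affine space of dimension
`m * n * n` through the (bijective) map of matrix entries. -/
@[reducible] def zariski (K : Type*) [Field K] (n m : ℕ) : TopologicalSpace (MatTuple K n m) :=
  TopologicalSpace.induced coords (zariskiTopology K (Fin m × Fin n × Fin n))

/-- The orbit of `A` under simultaneous conjugation by `GL n K`. -/
def orbit (A : MatTuple K n m) : Set (MatTuple K n m) :=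
  {B | ∃ g : GL (Fin n) K, ∀ i,
    B i = (g : Matrix (Fin n) (Fin n) K) * A i * ((g⁻¹ : GL (Fin n) K) : Matrix (Fin n) (Fin n) K)}

/-- The dimension of the orbit of `A`: its Krull dimension as a topological space, for the
topology induced by the Zariski topology. -/
def orbitDim (A : MatTuple K n m) : WithBot ℕ∞ :=
  @topologicalKrullDim (orbit A) (@instTopologicalSpaceSubtype _ (· ∈ orbit A) (zariski K n m))

/-- For a `k × l` matrix `φ` of non-commutative polynomials in `x₁, …, xₘ`, the block matrix
`φ(A)` of size `kn × ln` over `K`, whose `(i, j)` block is `φ i j` evaluated at `A`. -/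
def evalMatrix {k l : ℕ} (φ : Matrix (Fin k) (Fin l) (FreeAlgebra K (Fin m)))
    (A : MatTuple K n m) : Matrix (Fin k × Fin n) (Fin l × Fin n) K :=
  Matrix.of fun p q => (FreeAlgebra.lift K A (φ p.1 q.1)) p.2 q.2

/-- `A ≤_hom B`: the rank of `φ(A)` is at least the rank of `φ(B)`, for all rectangular
matrices `φ` over the free associative algebra. -/
def HomLE (A B : MatTuple K n m) : Prop :=
  ∀ (k l : ℕ) (φ : Matrix (Fin k) (Fin l) (FreeAlgebra K (Fin m))),
    (evalMatrix φ B).rank ≤ (evalMatrix φ A).rank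

/-- `A <_hom B`: `A ≤_hom B` and the orbits of `A` and `B` are distinct. -/
def HomLT (A B : MatTuple K n m) : Prop :=
  HomLE A B ∧ orbit A ≠ orbit B

end MatTuple

end

/-! View `A` as a module `M` over the free algebra on `K ^ n`, and `B` as `N`; write `[X, Y]` for
the dimension of the space of homomorphisms. The proof has two independent halves, joined by the
fact that the endomorphisms of `M` are the matrices commuting with `A`.

Geometry (`orbitDim_eq`): the orbit has dimension `n * n - [M, M]`. Near `A` it is parametrized by
conjugation with `1 + w`, for `w` in a complement of the commutant. The inverse is rational: the
matrices intertwining `A` with a point `X` of the orbit form a space of the same dimension as the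
commutant, so for `X` near `A` exactly one of them has the form `1 + w`, and Cramer's rule computes
it. The orbit is thus locally homeomorphic to open sets of affine space (`exists_chart`), which
gives its Krull dimension.

Algebra (`nonempty_linearEquiv_of_homDim_le`): a homomorphism to or from a fixed finite-dimensional
`X` solves a linear system whose matrix is an evaluated polynomial matrix. The rank inequalities
therefore give `[X, M] ≤ [X, N]` and `[M, X] ≤ [N, X]`. If also `[N, N] ≤ [M, M]`, a dimension count
splits the universal map from `M` to a power of `N` (`exists_sum_comp_eq_id`). A Fitting argument
then yields a nonzero common summand of `M` and `N`, and induction on dimension applies to the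
complements. So `[M, M] < [N, N]` whenever the orbits differ. -/

open TopologicalSpace Topology

/-! ### Krull dimension is local -/

section KrullDimension

/-- A space has Krull dimension at most `d` if each of its points has an open neighbourhood of
Krull dimension at most `d`. -/
theorem topologicalKrullDim_le_of_forall_exists_isOpen {X : Type*} [TopologicalSpace X]
    {d : WithBot ℕ∞}
    (h : ∀ x : X, ∃ U : Set X, IsOpen U ∧ x ∈ U ∧ topologicalKrullDim U ≤ d) :
    topologicalKrullDim X ≤ d := by
  refine iSup_le fun p => ?_
  obtain ⟨x, hx⟩ := p.head.isIrreducible.nonempty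
  obtain ⟨U, hU, hxU, hd⟩ := h x
  refine le_trans ?_ hd
  rw [topologicalKrullDim, Order.le_krullDim_iff]
  -- Irreducible closed subsets of `U` correspond to those of `X` that meet `U`. All members of the
  -- chain do, since `x` lies in the smallest one.
  let e := IrreducibleCloseds.orderIsoOfIsOpenEmbedding _ hU.isOpenEmbedding_subtypeVal
  have hmem : ∀ i, (Subtype.val ⁻¹' (p i : Set X) : Set U).Nonempty := fun i =>
    ⟨⟨x, hxU⟩, (LTSeries.head_le p i : p.head ≤ p i) hx⟩
  refine ⟨⟨p.length, fun i => e.symm ⟨p i, hmem i⟩, fun i => ?_⟩, rfl⟩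
  exact e.symm.lt_iff_lt.2 (p.step i)

end KrullDimension

/-! ### The Zariski topology on affine space -/

section Zariski

attribute [local instance] zariskiTopology

variable {K σ τ : Type*} [Field K]

theorem isClosed_zariski_iff {Z : Set (σ → K)} :
    IsClosed Z ↔ ∃ I : Ideal (MvPolynomial σ K), Z = MvPolynomial.zeroLocus K I := by
  rw [← isOpen_compl_iff]
  change Zᶜᶜ ∈ _ ↔ _
  rw [compl_compl]
  rfl

theorem isClosed_setOf_eval_eq_zero (p : MvPolynomial σ K) :
    IsClosed {x : σ → K | MvPolynomial.eval x p = 0} :=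
  isClosed_zariski_iff.2 ⟨Ideal.span {p}, by
    rw [MvPolynomial.zeroLocus_span]; simp [MvPolynomial.aeval_eq_eval]⟩

theorem IsClosed.zeroLocus_vanishingIdeal_eq {Z : Set (σ → K)} (hZ : IsClosed Z) :
    MvPolynomial.zeroLocus K (MvPolynomial.vanishingIdeal K Z) = Z := by
  obtain ⟨I, rfl⟩ := isClosed_zariski_iff.1 hZ
  exact (MvPolynomial.zeroLocus_vanishingIdeal_galoisConnection (k := K) (K := K)).l_u_l_eq_l I

theorem IsIrreducible.isPrime_vanishingIdeal {Z : Set (σ → K)} (hZ : IsIrreducible Z) :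
    (MvPolynomial.vanishingIdeal K Z).IsPrime := by
  refine Ideal.isPrime_iff.2 ⟨fun h => ?_, fun {p q} hpq => ?_⟩
  · obtain ⟨x, hx⟩ := hZ.nonempty
    have : (1 : MvPolynomial σ K) ∈ MvPolynomial.vanishingIdeal K Z := h ▸ Submodule.mem_top
    simpa using this x hx
  · have hcl := isPreirreducible_iff_isClosed_union_isClosed.1 hZ.isPreirreducible _ _
      (isClosed_setOf_eval_eq_zero p) (isClosed_setOf_eval_eq_zero q) fun x hx => by
        have := hpq x hx
        rw [map_mul, mul_eq_zero] at this
        exact this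
    exact hcl

/-- A closed set is recovered from its vanishing ideal, so irreducible closed sets embed, with order
reversed, into the primes of a polynomial ring of known dimension. The Nullstellensatz is not needed
for this bound. -/
theorem topologicalKrullDim_zariski_le [Finite σ] :
    topologicalKrullDim (σ → K) ≤ Nat.card σ := by
  have h : ringKrullDim (MvPolynomial σ K) = Nat.card σ := by
    rw [MvPolynomial.ringKrullDim_of_isNoetherianRing, ringKrullDim_eq_zero_of_field, zero_add]
  rw [← h, ringKrullDim, ← Order.krullDim_orderDual]
  refine Order.krullDim_le_of_strictMono
    (fun Z => OrderDual.toDual ⟨MvPolynomial.vanishingIdeal K (Z : Set (σ → K)),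
      Z.isIrreducible.isPrime_vanishingIdeal⟩) fun Z Z' hlt => ?_
  refine lt_of_le_not_ge (MvPolynomial.vanishingIdeal_anti_mono (A := (Z : Set (σ → K))) hlt.le)
    fun hle => hlt.not_ge ?_
  have := MvPolynomial.zeroLocus_anti_mono (K := K) hle
  change MvPolynomial.zeroLocus K (MvPolynomial.vanishingIdeal K (Z' : Set (σ → K))) ≤
    MvPolynomial.zeroLocus K (MvPolynomial.vanishingIdeal K (Z : Set (σ → K))) at this
  rwa [Z.isClosed.zeroLocus_vanishingIdeal_eq, Z'.isClosed.zeroLocus_vanishingIdeal_eq] at this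

/-! ### Regular functions and their continuity -/

/-- The functions on `X` that are globally fractions of polynomials in the coordinates `c`. -/
def regularFunctions {X : Type*} (c : X → σ → K) : Subalgebra K (X → K) where
  carrier := {f | ∃ P Q : MvPolynomial σ K, ∀ x,
    MvPolynomial.eval (c x) Q ≠ 0 ∧ f x * MvPolynomial.eval (c x) Q = MvPolynomial.eval (c x) P}
  mul_mem' := by
    rintro f g ⟨P, Q, h⟩ ⟨P', Q', h'⟩
    refine ⟨P * P', Q * Q', fun x => ?_⟩
    simp only [map_mul, Pi.mul_apply]
    exact ⟨mul_ne_zero (h x).1 (h' x).1, by rw [← (h x).2, ← (h' x).2]; ring⟩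
  add_mem' := by
    rintro f g ⟨P, Q, h⟩ ⟨P', Q', h'⟩
    refine ⟨P * Q' + P' * Q, Q * Q', fun x => ?_⟩
    simp only [map_mul, map_add, Pi.add_apply]
    exact ⟨mul_ne_zero (h x).1 (h' x).1, by rw [← (h x).2, ← (h' x).2]; ring⟩
  algebraMap_mem' r := ⟨MvPolynomial.C r, 1, fun x => by simp⟩

section Regular

variable {X : Type*} {c : X → σ → K}

theorem coord_mem_regularFunctions (i : σ) : (fun x => c x i) ∈ regularFunctions c :=
  ⟨MvPolynomial.X i, 1, fun x => by simp⟩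

theorem const_mem_regularFunctions (r : K) : (fun _ => r) ∈ regularFunctions c :=
  (regularFunctions c).algebraMap_mem r

theorem inv_mem_regularFunctions {f : X → K} (hf : f ∈ regularFunctions c) (h0 : ∀ x, f x ≠ 0) :
    (fun x => (f x)⁻¹) ∈ regularFunctions c := by
  obtain ⟨P, Q, h⟩ := hf
  refine ⟨Q, P, fun x => ?_⟩
  rw [← (h x).2]
  exact ⟨mul_ne_zero (h0 x) (h x).1, inv_mul_cancel_left₀ (h0 x) _⟩

theorem comp_mem_regularFunctions {Y : Type*} {f : X → K} (hf : f ∈ regularFunctions c)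
    (e : Y → X) : (fun y => f (e y)) ∈ regularFunctions fun y => c (e y) := by
  obtain ⟨P, Q, h⟩ := hf
  exact ⟨P, Q, fun y => h (e y)⟩

theorem sum_mem_regularFunctions {ι : Type*} (s : Finset ι) {f : ι → X → K}
    (hf : ∀ i ∈ s, f i ∈ regularFunctions c) :
    (fun x => ∑ i ∈ s, f i x) ∈ regularFunctions c := by
  convert (regularFunctions c).sum_mem hf using 1
  ext x
  simp

theorem mul_mem_regularFunctions {f g : X → K} (hf : f ∈ regularFunctions c)
    (hg : g ∈ regularFunctions c) : (fun x => f x * g x) ∈ regularFunctions c :=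
  (regularFunctions c).mul_mem hf hg

theorem add_mem_regularFunctions {f g : X → K} (hf : f ∈ regularFunctions c)
    (hg : g ∈ regularFunctions c) : (fun x => f x + g x) ∈ regularFunctions c :=
  (regularFunctions c).add_mem hf hg

theorem sub_mem_regularFunctions {f g : X → K} (hf : f ∈ regularFunctions c)
    (hg : g ∈ regularFunctions c) : (fun x => f x - g x) ∈ regularFunctions c :=
  (regularFunctions c).sub_mem hf hg

theorem matrix_mul_mem_regularFunctions {l m n : Type*} [Fintype m]
    {M : X → Matrix l m K} {N : X → Matrix m n K}
    (hM : ∀ i j, (fun x => M x i j) ∈ regularFunctions c)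
    (hN : ∀ i j, (fun x => N x i j) ∈ regularFunctions c) (i : l) (j : n) :
    (fun x => (M x * N x) i j) ∈ regularFunctions c := by
  simp only [Matrix.mul_apply]
  exact sum_mem_regularFunctions _ fun k _ => mul_mem_regularFunctions (hM i k) (hN k j)

theorem mulVec_mem_regularFunctions {l m : Type*} [Fintype m]
    {M : X → Matrix l m K} {v : X → m → K}
    (hM : ∀ i j, (fun x => M x i j) ∈ regularFunctions c)
    (hv : ∀ j, (fun x => v x j) ∈ regularFunctions c) (i : l) :
    (fun x => (M x).mulVec (v x) i) ∈ regularFunctions c := by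
  simp only [Matrix.mulVec, dotProduct]
  exact sum_mem_regularFunctions _ fun k _ => mul_mem_regularFunctions (hM i k) (hv k)

theorem det_mem_regularFunctions {n : Type*} [Fintype n] [DecidableEq n]
    {M : X → Matrix n n K} (hM : ∀ i j, (fun x => M x i j) ∈ regularFunctions c) :
    (fun x => (M x).det) ∈ regularFunctions c := by
  -- The determinant is taken in the ring of all functions on `X`, where closure of a subalgebra
  -- under sums and products applies.
  have : (fun x => (M x).det) =
      (Matrix.of fun i j => (fun x => M x i j) : Matrix n n (X → K)).det := by
    ext x
    exact (RingHom.map_det (Pi.evalRingHom (fun _ : X => K) x)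
      (Matrix.of fun i j => (fun x => M x i j) : Matrix n n (X → K))).symm
  rw [this, Matrix.det_apply]
  refine sum_mem fun s _ => ?_
  rw [Units.smul_def]
  exact zsmul_mem ((regularFunctions c).prod_mem fun i _ => hM _ _) _

theorem adjugate_mem_regularFunctions {n : Type*} [Fintype n] [DecidableEq n]
    {M : X → Matrix n n K} (hM : ∀ i j, (fun x => M x i j) ∈ regularFunctions c) (i j : n) :
    (fun x => (M x).adjugate i j) ∈ regularFunctions c := by
  simp only [Matrix.adjugate_apply]
  refine det_mem_regularFunctions fun a b => ?_
  by_cases ha : a = j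
  · subst ha
    simpa only [Matrix.updateRow_self] using const_mem_regularFunctions _
  · simpa only [Matrix.updateRow_ne ha] using hM a b

theorem matrix_inv_mem_regularFunctions {n : Type*} [Fintype n] [DecidableEq n]
    {M : X → Matrix n n K} (hM : ∀ i j, (fun x => M x i j) ∈ regularFunctions c)
    (h0 : ∀ x, (M x).det ≠ 0) (i j : n) :
    (fun x => (M x)⁻¹ i j) ∈ regularFunctions c := by
  simp only [Matrix.inv_def, Ring.inverse_eq_inv', Matrix.smul_apply, smul_eq_mul]
  exact mul_mem_regularFunctions (inv_mem_regularFunctions (det_mem_regularFunctions hM) h0)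
    (adjugate_mem_regularFunctions hM i j)

theorem linearMap_mem_regularFunctions {ι V : Type*} [Finite ι] [AddCommGroup V] [Module K V]
    (b : Module.Basis ι K V) {v : X → V}
    (hv : ∀ i, (fun x => b.repr (v x) i) ∈ regularFunctions c) (l : V →ₗ[K] K) :
    (fun x => l (v x)) ∈ regularFunctions c := by
  have := Fintype.ofFinite ι
  have h : (fun x => l (v x)) = fun x => ∑ i, b.repr (v x) i * l (b i) := by
    ext x
    conv_lhs => rw [← b.sum_repr (v x), map_sum]
    simp only [map_smul, smul_eq_mul]
  rw [h]
  exact sum_mem_regularFunctions _ fun i _ =>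
    mul_mem_regularFunctions (hv i) (const_mem_regularFunctions _)

theorem eval_mem_regularFunctions {F : X → τ → K}
    (hF : ∀ j, (fun x => F x j) ∈ regularFunctions c) (p : MvPolynomial τ K) :
    (fun x => MvPolynomial.eval (F x) p) ∈ regularFunctions c := by
  induction p using MvPolynomial.induction_on with
  | C r => simpa using const_mem_regularFunctions r
  | add p q hp hq => simpa using add_mem_regularFunctions hp hq
  | mul_X p i hp => simpa using mul_mem_regularFunctions hp (hF i)

theorem isOpen_setOf_ne_zero_of_mem_regularFunctions [TopologicalSpace X] (hc : Continuous c)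
    {f : X → K} (hf : f ∈ regularFunctions c) : IsOpen {x | f x ≠ 0} := by
  obtain ⟨P, Q, h⟩ := hf
  have : {x | f x ≠ 0} = c ⁻¹' {y | MvPolynomial.eval y P = 0}ᶜ := by
    ext x
    simp [← (h x).2, (h x).1]
  rw [this]
  exact (isClosed_setOf_eval_eq_zero P).isOpen_compl.preimage hc

theorem continuous_of_mem_regularFunctions [TopologicalSpace X] (hc : Continuous c)
    {F : X → τ → K} (hF : ∀ j, (fun x => F x j) ∈ regularFunctions c) : Continuous F := by
  refine continuous_iff_isClosed.2 fun Z hZ => ?_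
  obtain ⟨I, rfl⟩ := isClosed_zariski_iff.1 hZ
  have : F ⁻¹' MvPolynomial.zeroLocus K I =
      ⋂ p ∈ I, {x | MvPolynomial.eval (F x) p ≠ 0}ᶜ := by
    ext x
    simp [MvPolynomial.aeval_eq_eval]
  rw [this]
  exact isClosed_biInter fun p _ => (isOpen_setOf_ne_zero_of_mem_regularFunctions hc
    (eval_mem_regularFunctions hF p)).isClosed_compl

end Regular

/-! ### Irreducible subspaces and the lower bound for the dimension -/

theorem irreducibleSpace_zariski [Infinite K] : IrreducibleSpace (σ → K) where
  isPreirreducible_univ := by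
    refine isPreirreducible_iff_isClosed_union_isClosed.2 fun Z Z' hZ hZ' h => ?_
    by_contra! hn
    obtain ⟨⟨x, -, hx⟩, ⟨y, -, hy⟩⟩ := hn.imp Set.not_subset.1 Set.not_subset.1
    rw [← hZ.zeroLocus_vanishingIdeal_eq] at hx
    rw [← hZ'.zeroLocus_vanishingIdeal_eq] at hy
    simp only [MvPolynomial.mem_zeroLocus_iff, not_forall] at hx hy
    obtain ⟨p, hp, hpx⟩ := hx
    obtain ⟨q, hq, hqy⟩ := hy
    have h0 : p * q = 0 := MvPolynomial.funext fun z => by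
      rw [map_mul, map_zero, mul_eq_zero]
      exact (h (Set.mem_univ z)).imp (fun hz => hp z hz) fun hz => hq z hz
    rcases mul_eq_zero.1 h0 with rfl | rfl
    · simp at hpx
    · simp at hqy
  toNonempty := inferInstance

/-- The points that agree with `p` in all coordinates from `i` on. -/
def coordinateSubspace {d : ℕ} (p : Fin d → K) (i : ℕ) : Set (Fin d → K) :=
  {x | ∀ j : Fin d, i ≤ j → x j = p j}

theorem isClosed_coordinateSubspace {d : ℕ} (p : Fin d → K) (i : ℕ) :
    IsClosed (coordinateSubspace p i) := by
  have : coordinateSubspace p i = ⋂ (j : Fin d) (_ : i ≤ j),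
      {x | MvPolynomial.eval x (MvPolynomial.X j - MvPolynomial.C (p j)) = 0} := by
    ext x
    simp [coordinateSubspace, sub_eq_zero]
  rw [this]
  exact isClosed_iInter fun j => isClosed_iInter fun _ => isClosed_setOf_eval_eq_zero _

theorem isIrreducible_coordinateSubspace [Infinite K] {d : ℕ} (p : Fin d → K) (i : ℕ) :
    IsIrreducible (coordinateSubspace p i) := by
  have : IrreducibleSpace (Fin d → K) := irreducibleSpace_zariski
  -- The subspace is the continuous image, under this retraction, of the irreducible affine space.
  let r : (Fin d → K) → Fin d → K := fun x j => if i ≤ j then p j else x j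
  have hr : Continuous r := by
    refine continuous_of_mem_regularFunctions continuous_id fun j => ?_
    by_cases hj : i ≤ j
    · simpa [r, hj] using const_mem_regularFunctions _
    · simpa [r, hj] using coord_mem_regularFunctions (c := id) j
  have h : coordinateSubspace p i = r '' Set.univ := by
    ext x
    simp only [coordinateSubspace, Set.mem_ofPred_eq, Set.image_univ, Set.mem_range]
    constructor
    · intro hx
      refine ⟨x, funext fun j => ?_⟩
      by_cases hj : i ≤ j
      · simp [r, hj, hx j hj]
      · simp [r, hj]
    · rintro ⟨y, rfl⟩ j hj
      simp [r, hj]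
  rw [h]
  exact (IrreducibleSpace.isIrreducible_univ _).image r hr.continuousOn

/-- The flag of coordinate subspaces through one point of the open set traces a chain of `d + 1`
irreducible closed sets on it. -/
theorem le_topologicalKrullDim_of_isOpenEmbedding [Infinite K] {d : ℕ} {Y : Type*}
    [TopologicalSpace Y] [Nonempty Y] {f : Y → Fin d → K} (hf : IsOpenEmbedding f) :
    (d : WithBot ℕ∞) ≤ topologicalKrullDim Y := by
  obtain ⟨y⟩ := ‹Nonempty Y›
  have hmem : ∀ i, f y ∈ coordinateSubspace (f y) i := fun i j _ => rfl
  rw [topologicalKrullDim, Order.le_krullDim_iff]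
  refine ⟨⟨d, fun i => ⟨f ⁻¹' coordinateSubspace (f y) i,
    (isIrreducible_coordinateSubspace (f y) i).preimage hf ⟨f y, hmem i, y, rfl⟩,
    (isClosed_coordinateSubspace (f y) i).preimage hf.continuous⟩, fun i => ?_⟩, rfl⟩
  have hmono : coordinateSubspace (f y) i ⊆ coordinateSubspace (f y) (i + 1) :=
    fun z hz j hj => hz j (by omega)
  refine lt_of_le_not_ge (by simpa using Set.preimage_mono (f := f) hmono) fun hle => ?_
  -- Strictness: inside the irreducible larger subspace, the range of `f` and the locus where
  -- coordinate `i` differs from that of `f y` are both open and nonempty, so they meet. The value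
  -- `t` witnesses that the second is nonempty.
  obtain ⟨t, ht⟩ := exists_ne (f y i)
  obtain ⟨x, hx, ⟨z, rfl⟩, hxi⟩ := (isIrreducible_coordinateSubspace (f y) (i + 1)).isPreirreducible
    _ _ hf.isOpen_range (isClosed_setOf_eval_eq_zero
      (MvPolynomial.X i - MvPolynomial.C (f y i))).isOpen_compl ⟨f y, hmem _, y, rfl⟩
      ⟨Function.update (f y) i t, fun j hj => Function.update_of_ne (by
        rintro rfl; omega) _ _, by simpa [sub_eq_zero] using ht⟩
  have : f z i = f y i := hle (show z ∈ _ from by simpa using hx) i (by simp)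
  simp [this] at hxi

end Zariski

/-! ### Orbits, intertwiners and commutants -/

namespace MatTuple

attribute [local instance] zariskiTopology zariski

variable {K : Type*} [Field K] {n m : ℕ}

/-- The linear map sending `h` to the defect of `h` to intertwine `A` with `X`. -/
noncomputable def intertwiner (X A : MatTuple K n m) :
    Matrix (Fin n) (Fin n) K →ₗ[K] MatTuple K n m where
  toFun h i := X i * h - h * A i
  map_add' h h' := by ext1 i; simp only [Matrix.mul_add, Matrix.add_mul, Pi.add_apply]; abel
  map_smul' r h := by ext1 i; simp [smul_sub]

theorem intertwiner_apply (X A : MatTuple K n m) (h : Matrix (Fin n) (Fin n) K) (i : Fin m) :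
    intertwiner X A h i = X i * h - h * A i := rfl

theorem mem_ker_intertwiner {X A : MatTuple K n m} {h : Matrix (Fin n) (Fin n) K} :
    h ∈ (intertwiner X A).ker ↔ ∀ i, X i * h = h * A i := by
  simp [funext_iff, intertwiner_apply, sub_eq_zero]

/-- The matrices commuting with all members of the tuple `A`. -/
noncomputable def commutant (A : MatTuple K n m) : Submodule K (Matrix (Fin n) (Fin n) K) :=
  (intertwiner A A).ker

theorem mem_orbit_iff {X A : MatTuple K n m} :
    X ∈ orbit A ↔ ∃ g : Matrix (Fin n) (Fin n) K, g.det ≠ 0 ∧ ∀ i, X i * g = g * A i := by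
  constructor
  · rintro ⟨g, hg⟩
    refine ⟨g, (Matrix.isUnits_det_units g).ne_zero, fun i => ?_⟩
    rw [hg i, mul_assoc, Units.inv_mul, mul_one]
  · rintro ⟨g, hg, h⟩
    refine ⟨Matrix.GeneralLinearGroup.mkOfDetNeZero g hg, fun i => ?_⟩
    change X i = g * A i * _
    rw [← h i, mul_assoc]
    exact (by rw [Units.mul_inv (Matrix.GeneralLinearGroup.mkOfDetNeZero g hg), mul_one] :
      X i = X i * (Matrix.GeneralLinearGroup.mkOfDetNeZero g hg * _))

theorem self_mem_orbit (A : MatTuple K n m) : A ∈ orbit A :=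
  mem_orbit_iff.2 ⟨1, by simp, by simp⟩

theorem orbit_subset_orbit {X A : MatTuple K n m} (h : X ∈ orbit A) : orbit X ⊆ orbit A := by
  intro Y hY
  obtain ⟨g, hg, h⟩ := mem_orbit_iff.1 h
  obtain ⟨g', hg', h'⟩ := mem_orbit_iff.1 hY
  exact mem_orbit_iff.2 ⟨g' * g, by simp [hg, hg'], fun i => by
    rw [← mul_assoc, h', mul_assoc, h, mul_assoc]⟩

theorem mem_orbit_symm {X A : MatTuple K n m} (h : X ∈ orbit A) : A ∈ orbit X := by
  obtain ⟨g, hg, h⟩ := mem_orbit_iff.1 h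
  have hu : IsUnit g.det := isUnit_iff_ne_zero.2 hg
  refine mem_orbit_iff.2 ⟨g⁻¹, by simpa using hg, fun i => ?_⟩
  rw [← Matrix.mul_nonsing_inv_cancel_right g (A i * g⁻¹) hu, mul_assoc (A i),
    Matrix.nonsing_inv_mul _ hu, ← Matrix.nonsing_inv_mul_cancel_left g (A i * 1 * g⁻¹) hu]
  rw [mul_one, ← mul_assoc g, ← h i, mul_assoc (X i), Matrix.mul_nonsing_inv _ hu, mul_one]

theorem orbit_eq_of_mem {X A : MatTuple K n m} (h : X ∈ orbit A) : orbit X = orbit A :=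
  (orbit_subset_orbit h).antisymm (orbit_subset_orbit (mem_orbit_symm h))

theorem finrank_ker_intertwiner_le_left {X A : MatTuple K n m} (h : A ∈ orbit X)
    (B : MatTuple K n m) :
    Module.finrank K (intertwiner X B).ker ≤ Module.finrank K (intertwiner A B).ker := by
  obtain ⟨g, hg, h⟩ := mem_orbit_iff.1 h
  have hu : IsUnit g.det := isUnit_iff_ne_zero.2 hg
  refine LinearMap.finrank_le_finrank_of_injective
    (f := (LinearMap.mulLeft K g).restrict fun k hk => mem_ker_intertwiner.2 fun i => ?_) ?_
  · rw [LinearMap.mulLeft_apply, ← mul_assoc, h, mul_assoc, mem_ker_intertwiner.1 hk, mul_assoc]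
  · intro k k' hkk
    have h1 : g * (k : Matrix (Fin n) (Fin n) K) = g * k' := congr_arg Subtype.val hkk
    have h2 := congr_arg (g⁻¹ * ·) h1
    simp only [Matrix.nonsing_inv_mul_cancel_left _ _ hu] at h2
    exact Subtype.ext h2

theorem finrank_ker_intertwiner_le_right {X A : MatTuple K n m} (h : X ∈ orbit A)
    (B : MatTuple K n m) :
    Module.finrank K (intertwiner B X).ker ≤ Module.finrank K (intertwiner B A).ker := by
  obtain ⟨g, hg, h⟩ := mem_orbit_iff.1 h
  have hu : IsUnit g.det := isUnit_iff_ne_zero.2 hg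
  refine LinearMap.finrank_le_finrank_of_injective
    (f := (LinearMap.mulRight K g).restrict fun k hk => mem_ker_intertwiner.2 fun i => ?_) ?_
  · rw [LinearMap.mulRight_apply, ← mul_assoc, mem_ker_intertwiner.1 hk, mul_assoc, h, mul_assoc]
  · intro k k' hkk
    have h1 : (k : Matrix (Fin n) (Fin n) K) * g = k' * g := congr_arg Subtype.val hkk
    have h2 := congr_arg (· * g⁻¹) h1
    simp only [Matrix.mul_nonsing_inv_cancel_right _ _ hu] at h2
    exact Subtype.ext h2

/-- Left multiplication by a conjugating matrix carries intertwiners to elements of the commutant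
and back. The constancy of this dimension along the orbit is what makes the charts work. -/
theorem finrank_ker_intertwiner {X A : MatTuple K n m} (h : X ∈ orbit A) :
    Module.finrank K (intertwiner X A).ker = Module.finrank K (commutant A) :=
  (finrank_ker_intertwiner_le_left (mem_orbit_symm h) A).antisymm
    (finrank_ker_intertwiner_le_left h A)

theorem finrank_commutant_eq {X A : MatTuple K n m} (h : X ∈ orbit A) :
    Module.finrank K (commutant X) = Module.finrank K (commutant A) :=
  ((finrank_ker_intertwiner_le_right h X).antisymm
    (finrank_ker_intertwiner_le_right (mem_orbit_symm h) X)).trans (finrank_ker_intertwiner h)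

/-- The matrix entries of a tuple, as a linear equivalence. -/
noncomputable def coordsEquiv (K : Type*) [Field K] (n m : ℕ) :
    MatTuple K n m ≃ₗ[K] (Fin m × Fin n × Fin n → K) where
  toFun := coords
  map_add' _ _ := rfl
  map_smul' _ _ := rfl
  invFun f i := Matrix.of fun a b => f (i, a, b)
  left_inv _ := rfl
  right_inv _ := rfl

theorem linearMap_tuple_mem_regularFunctions {σ X : Type*} {c : X → σ → K}
    {F : X → MatTuple K n m} (hF : ∀ i a b, (fun x => F x i a b) ∈ regularFunctions c)
    (l : MatTuple K n m →ₗ[K] K) : (fun x => l (F x)) ∈ regularFunctions c :=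
  linearMap_mem_regularFunctions (Module.Basis.ofEquivFun (coordsEquiv K n m))
    (fun i => by simpa using! hF i.1 i.2.1 i.2.2) l

theorem linearMap_pi_mem_regularFunctions {σ X : Type*} {c : X → σ → K} {d : ℕ}
    {F : X → Fin d → K} (hF : ∀ i, (fun x => F x i) ∈ regularFunctions c)
    (l : (Fin d → K) →ₗ[K] K) : (fun x => l (F x)) ∈ regularFunctions c :=
  linearMap_mem_regularFunctions (Pi.basisFun K (Fin d)) (by simpa using hF) l

theorem continuous_coords : Continuous (coords : MatTuple K n m → _) :=
  continuous_induced_dom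

theorem continuous_orbit_mk {X σ : Type*} [TopologicalSpace X] {c : X → σ → K}
    (hc : Continuous c) {A : MatTuple K n m} {F : X → MatTuple K n m} (hF : ∀ x, F x ∈ orbit A)
    (h : ∀ i a b, (fun x => F x i a b) ∈ regularFunctions c) :
    Continuous fun x => (⟨F x, hF x⟩ : orbit A) :=
  (continuous_induced_rng.2 (continuous_of_mem_regularFunctions (F := fun x => coords (F x)) hc
    fun i => h i.1 i.2.1 i.2.2)).subtype_mk _

/-! ### Rational charts of an orbit -/

section Chart

variable (A : MatTuple K n m) {d : ℕ} (s : (Fin d → K) →ₗ[K] Matrix (Fin n) (Fin n) K)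
  (π : MatTuple K n m →ₗ[K] (Fin d → K))

/-- The matrix of the linear system for the parameter `w` of a conjugating matrix `1 + s w`. -/
noncomputable def chartMatrix (X : MatTuple K n m) : Matrix (Fin d) (Fin d) K :=
  LinearMap.toMatrix' (π ∘ₗ intertwiner X A ∘ₗ s)

/-- The numerator, over the determinant of `chartMatrix`, of the parameter of a conjugating
matrix, according to Cramer's rule. -/
noncomputable def chartNumerator (X : MatTuple K n m) : Fin d → K :=
  (chartMatrix A s π X).adjugate.mulVec (π (A - X))

/-- The numerator of the conjugating matrix from `A` to `X`. -/
noncomputable def chartConjugator (X : MatTuple K n m) : Matrix (Fin n) (Fin n) K :=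
  (chartMatrix A s π X).det • 1 + s (chartNumerator A s π X)

/-- The inverse chart: conjugation of `A` by `1 + s w`. -/
noncomputable def chartConj (w : Fin d → K) : MatTuple K n m :=
  fun i => (1 + s w) * A i * (1 + s w)⁻¹

variable {A s π}

theorem chartMatrix_mulVec (X : MatTuple K n m) (w : Fin d → K) :
    (chartMatrix A s π X).mulVec w = π (intertwiner X A (s w)) := by
  rw [chartMatrix, LinearMap.toMatrix'_mulVec]
  rfl

theorem intertwiner_one (X : MatTuple K n m) : intertwiner X A 1 = X - A := by
  ext1 i
  simp [intertwiner_apply]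

theorem chartMatrix_mulVec_eq_of_mem_ker {X : MatTuple K n m} {w : Fin d → K}
    (h : 1 + s w ∈ (intertwiner X A).ker) :
    (chartMatrix A s π X).mulVec w = π (A - X) := by
  rw [LinearMap.mem_ker, map_add, intertwiner_one] at h
  rw [chartMatrix_mulVec, eq_neg_of_add_eq_zero_right h, neg_sub]

/-- The system only says that the intertwining defect of `1 + s w` is killed by `π`; on the orbit
this suffices. A nonzero determinant makes `s` injective with range disjoint from the intertwiners,
and by dimension the two are complementary. Hence some `1 + s (-v)` is an intertwiner; it solves the
same invertible system, so `w = -v`. -/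
theorem mem_ker_of_chartMatrix_mulVec_eq {X : MatTuple K n m} (hX : X ∈ orbit A)
    (hd : d + Module.finrank K (commutant A) = n * n)
    (hdet : (chartMatrix A s π X).det ≠ 0) {w : Fin d → K}
    (h : (chartMatrix A s π X).mulVec w = π (A - X)) :
    1 + s w ∈ (intertwiner X A).ker := by
  have hu : IsUnit (chartMatrix A s π X).det := isUnit_iff_ne_zero.2 hdet
  have hinj := Matrix.mulVec_injective_of_isUnit ((Matrix.isUnit_iff_isUnit_det _).2 hu)
  have hker (v : Fin d → K) (hv : s v ∈ (intertwiner X A).ker) : v = 0 := by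
    apply hinj
    change (chartMatrix A s π X).mulVec v = (chartMatrix A s π X).mulVec 0
    rw [chartMatrix_mulVec, LinearMap.mem_ker.1 hv, map_zero, Matrix.mulVec_zero]
  have hs : Function.Injective s := (injective_iff_map_eq_zero s).2 fun v hv =>
    hker v (by rw [hv]; exact zero_mem _)
  have hdisj : Disjoint s.range (intertwiner X A).ker := by
    rw [Submodule.disjoint_def]
    rintro _ ⟨v, rfl⟩ hv
    rw [hker v hv, map_zero]
  have htop := Submodule.eq_top_of_disjoint s.range (intertwiner X A).ker (by
    rw [LinearMap.finrank_range_of_inj hs, finrank_ker_intertwiner hX]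
    simp [Module.finrank_matrix, hd]) hdisj
  obtain ⟨_, ⟨v, rfl⟩, k, hk, hvk⟩ := Submodule.mem_sup.1
    (htop ▸ Submodule.mem_top : (1 : Matrix (Fin n) (Fin n) K) ∈ _)
  have h1 : 1 + s (-v) ∈ (intertwiner X A).ker := by
    rwa [← hvk, map_neg, add_neg_eq_iff_eq_add.2 (add_comm _ _)]
  rwa [hinj ((chartMatrix_mulVec_eq_of_mem_ker h1).trans h.symm)] at h1

section Regular

variable {Y σ : Type*} {c : Y → σ → K} {X : Y → MatTuple K n m}

theorem chartMatrix_mem_regularFunctions (hX : ∀ i a b, (fun y => X y i a b) ∈ regularFunctions c)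
    (i j : Fin d) : (fun y => chartMatrix A s π (X y) i j) ∈ regularFunctions c := by
  simp only [chartMatrix, LinearMap.toMatrix'_apply]
  refine linearMap_tuple_mem_regularFunctions (F := fun y => intertwiner (X y) A
    (s (Pi.single j 1))) (fun i a b => ?_) (LinearMap.proj i ∘ₗ π)
  exact sub_mem_regularFunctions
    (matrix_mul_mem_regularFunctions (N := fun _ => s (Pi.single j 1)) (hX i)
      (fun _ _ => const_mem_regularFunctions _) a b)
    (const_mem_regularFunctions _)

theorem chartNumerator_mem_regularFunctions
    (hX : ∀ i a b, (fun y => X y i a b) ∈ regularFunctions c) (i : Fin d) :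
    (fun y => chartNumerator A s π (X y) i) ∈ regularFunctions c :=
  mulVec_mem_regularFunctions (v := fun y => π (A - X y))
    (adjugate_mem_regularFunctions (chartMatrix_mem_regularFunctions hX))
    (fun j => linearMap_tuple_mem_regularFunctions (F := fun y => A - X y)
      (fun i a b => sub_mem_regularFunctions (const_mem_regularFunctions _) (hX i a b))
      (LinearMap.proj j ∘ₗ π)) i

theorem section_mem_regularFunctions {F : Y → Fin d → K}
    (hF : ∀ i, (fun y => F y i) ∈ regularFunctions c) (a b : Fin n) :
    (fun y => s (F y) a b) ∈ regularFunctions c :=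
  linearMap_pi_mem_regularFunctions hF (Matrix.entryLinearMap K K a b ∘ₗ s)

theorem chartConjugator_mem_regularFunctions
    (hX : ∀ i a b, (fun y => X y i a b) ∈ regularFunctions c) (a b : Fin n) :
    (fun y => chartConjugator A s π (X y) a b) ∈ regularFunctions c :=
  add_mem_regularFunctions
    (mul_mem_regularFunctions (det_mem_regularFunctions (chartMatrix_mem_regularFunctions hX))
      (const_mem_regularFunctions _))
    (section_mem_regularFunctions (chartNumerator_mem_regularFunctions hX) a b)

theorem one_add_section_mem_regularFunctions {F : Y → Fin d → K}
    (hF : ∀ i, (fun y => F y i) ∈ regularFunctions c) (a b : Fin n) :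
    (fun y => (1 + s (F y)) a b) ∈ regularFunctions c :=
  add_mem_regularFunctions (const_mem_regularFunctions _) (section_mem_regularFunctions hF a b)

theorem chartConj_mem_regularFunctions {F : Y → Fin d → K}
    (hF : ∀ i, (fun y => F y i) ∈ regularFunctions c) (h0 : ∀ y, (1 + s (F y)).det ≠ 0)
    (i : Fin m) (a b : Fin n) :
    (fun y => chartConj A s (F y) i a b) ∈ regularFunctions c := by
  have h1 := one_add_section_mem_regularFunctions (s := s) hF
  have h2 := matrix_inv_mem_regularFunctions h1 h0
  have h3 := matrix_mul_mem_regularFunctions (N := fun _ => A i) h1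
    fun _ _ => const_mem_regularFunctions _
  exact matrix_mul_mem_regularFunctions h3 h2 a b

end Regular

theorem chartConj_mul {w : Fin d → K} (hw : (1 + s w).det ≠ 0) (i : Fin m) :
    chartConj A s w i * (1 + s w) = (1 + s w) * A i :=
  Matrix.nonsing_inv_mul_cancel_right _ _ (isUnit_iff_ne_zero.2 hw)

theorem chartConj_mem_orbit {w : Fin d → K} (hw : (1 + s w).det ≠ 0) :
    chartConj A s w ∈ orbit A :=
  mem_orbit_iff.2 ⟨1 + s w, hw, chartConj_mul hw⟩

theorem chartMatrix_mulVec_inv_smul_chartNumerator {X : MatTuple K n m}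
    (hdet : (chartMatrix A s π X).det ≠ 0) :
    (chartMatrix A s π X).mulVec ((chartMatrix A s π X).det⁻¹ • chartNumerator A s π X) =
      π (A - X) := by
  rw [Matrix.mulVec_smul, chartNumerator, Matrix.mulVec_mulVec, Matrix.mul_adjugate,
    Matrix.smul_mulVec, Matrix.one_mulVec, inv_smul_smul₀ hdet]

theorem one_add_section_inv_smul_chartNumerator {X : MatTuple K n m}
    (hdet : (chartMatrix A s π X).det ≠ 0) :
    1 + s ((chartMatrix A s π X).det⁻¹ • chartNumerator A s π X) =
      (chartMatrix A s π X).det⁻¹ • chartConjugator A s π X := by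
  rw [chartConjugator, smul_add, inv_smul_smul₀ hdet, map_smul]

end Chart

/-- A chart of the orbit of `A` around `A`: an open neighbourhood of `A` in the orbit is
homeomorphic to a nonempty open subset of an affine space. -/
theorem exists_chart (A : MatTuple K n m) {d : ℕ}
    (hd : d + Module.finrank K (commutant A) = n * n) :
    ∃ (D : Set (Fin d → K)) (U : Set (orbit A)) (D' : Set D) (φ : U → D) (ψ : D' → U),
      IsOpen D ∧ IsOpen U ∧ ⟨A, self_mem_orbit A⟩ ∈ U ∧ IsOpen D' ∧ D'.Nonempty ∧
        IsInducing φ ∧ IsInducing ψ := by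
  obtain ⟨W, hW⟩ := (commutant A).exists_isCompl
  have hWd : Module.finrank K W = d := by
    have h := Submodule.finrank_add_eq_of_isCompl hW
    rw [Module.finrank_matrix] at h
    simp at h
    omega
  let e : (Fin d → K) ≃ₗ[K] W := LinearEquiv.ofFinrankEq _ _ (by simp [hWd])
  let s : (Fin d → K) →ₗ[K] Matrix (Fin n) (Fin n) K := W.subtype ∘ₗ e.toLinearMap
  -- On a complement of the commutant the map `intertwiner A A` is injective. A left inverse as `π`
  -- makes the chart matrix at `A` the identity, so the chart is defined at `A`.
  obtain ⟨π, hπ⟩ := LinearMap.exists_leftInverse_of_injective (intertwiner A A ∘ₗ s) (by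
    refine LinearMap.ker_eq_bot'.2 fun w hw => ?_
    have : (e w : Matrix (Fin n) (Fin n) K) = 0 :=
      Submodule.disjoint_def.1 hW.disjoint _ hw (e w).2
    simpa using this)
  have hMA : chartMatrix A s π A = 1 := by rw [chartMatrix, hπ, LinearMap.toMatrix'_id]
  let D : Set (Fin d → K) := {w | (1 + s w).det ≠ 0}
  -- The first condition lets Cramer's rule solve for the parameter; the second makes the resulting
  -- conjugating matrix invertible.
  let U : Set (orbit A) := {X | (chartMatrix A s π X).det ≠ 0} ∩
    {X | (chartConjugator A s π X).det ≠ 0}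
  have hcO : Continuous fun X : orbit A => coords (X : MatTuple K n m) :=
    continuous_coords.comp continuous_subtype_val
  have hOreg (i a b) : (fun X : orbit A => (X : MatTuple K n m) i a b) ∈
      regularFunctions fun X : orbit A => coords (X : MatTuple K n m) :=
    coord_mem_regularFunctions (c := fun X : orbit A => coords (X : MatTuple K n m)) (i, a, b)
  have hD : IsOpen D := isOpen_setOf_ne_zero_of_mem_regularFunctions continuous_id
    (det_mem_regularFunctions (one_add_section_mem_regularFunctions
      (c := id) (F := id) fun i => coord_mem_regularFunctions (c := id) i))
  have hU : IsOpen U :=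
    (isOpen_setOf_ne_zero_of_mem_regularFunctions hcO
      (det_mem_regularFunctions (chartMatrix_mem_regularFunctions hOreg))).inter
    (isOpen_setOf_ne_zero_of_mem_regularFunctions hcO
      (det_mem_regularFunctions (chartConjugator_mem_regularFunctions hOreg)))
  have hAU : (⟨A, self_mem_orbit A⟩ : orbit A) ∈ U := by
    constructor <;> simp [chartConjugator, chartNumerator, hMA]
  let Ψ : D → orbit A := fun w => ⟨chartConj A s w, chartConj_mem_orbit w.2⟩
  have hΨ : Continuous Ψ := continuous_orbit_mk continuous_subtype_val _
    (chartConj_mem_regularFunctions (fun i => coord_mem_regularFunctions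
      (c := (Subtype.val : D → Fin d → K)) i) fun w => w.2)
  let D' : Set D := Ψ ⁻¹' U
  have hΨ0 : Ψ ⟨0, by simp [D]⟩ = ⟨A, self_mem_orbit A⟩ := by
    ext1; ext1 i
    simp [Ψ, chartConj]
  let f : U → Fin d → K := fun X =>
    (chartMatrix A s π X).det⁻¹ • chartNumerator A s π X
  have hf : Continuous f := by
    refine continuous_of_mem_regularFunctions (hcO.comp continuous_subtype_val) fun j => ?_
    have hUreg (i a b) := comp_mem_regularFunctions (hOreg i a b) (Subtype.val : U → orbit A)
    exact mul_mem_regularFunctions (inv_mem_regularFunctions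
      (det_mem_regularFunctions (chartMatrix_mem_regularFunctions hUreg)) fun X => X.2.1)
      (chartNumerator_mem_regularFunctions hUreg j)
  have hfD (X : U) : f X ∈ D := by
    change (1 + s (f X)).det ≠ 0
    rw [one_add_section_inv_smul_chartNumerator X.2.1, Matrix.det_smul]
    exact mul_ne_zero (pow_ne_zero _ (inv_ne_zero X.2.1)) X.2.2
  let φ : U → D := fun X => ⟨f X, hfD X⟩
  have hφ : Continuous φ := hf.subtype_mk _
  let ψ : D' → U := fun w => ⟨Ψ w, w.2⟩
  have hψ : Continuous ψ := (hΨ.comp continuous_subtype_val).subtype_mk _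
  -- By Cramer's rule `1 + s (f X)` intertwines `A` with `X`, so conjugating `A` by it returns `X`.
  have hΨφ : Ψ ∘ φ = Subtype.val := by
    ext1 X
    ext1
    ext1 i
    have h1 := mem_ker_intertwiner.1 (mem_ker_of_chartMatrix_mulVec_eq X.1.2 hd X.2.1
      (chartMatrix_mulVec_inv_smul_chartNumerator X.2.1)) i
    change (1 + s (f X)) * A i * (1 + s (f X))⁻¹ = _
    rw [← h1]
    exact Matrix.mul_nonsing_inv_cancel_right _ _ (isUnit_iff_ne_zero.2 (hfD X))
  -- Both parameters solve the same invertible system at the point `Ψ w`.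
  have hφψ : φ ∘ ψ = Subtype.val := by
    ext1 w
    ext1
    have hu : IsUnit (chartMatrix A s π (Ψ w)).det := isUnit_iff_ne_zero.2 w.2.1
    apply Matrix.mulVec_injective_of_isUnit ((Matrix.isUnit_iff_isUnit_det _).2 hu)
    exact (chartMatrix_mulVec_inv_smul_chartNumerator w.2.1).trans
      (chartMatrix_mulVec_eq_of_mem_ker
        (mem_ker_intertwiner.2 fun i => chartConj_mul w.1.2 i)).symm
  refine ⟨D, U, D', φ, ψ, hD, hU, hAU, hU.preimage hΨ, ⟨⟨0, by simp [D]⟩, ?_⟩, ?_, ?_⟩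
  · change Ψ _ ∈ U
    rwa [hΨ0]
  -- A continuous map that becomes an inclusion after composition with a continuous map is inducing.
  · exact .of_comp hφ hΨ (hΨφ ▸ IsInducing.subtypeVal)
  · exact .of_comp hψ hφ (hφψ ▸ IsInducing.subtypeVal)

/-- The map `φ` places a neighbourhood in affine space, which bounds the dimension above; `ψ` places
a nonempty open subset of affine space in the orbit, which bounds it below. -/
theorem orbitDim_eq [Infinite K] (A : MatTuple K n m) :
    orbitDim A = ((n * n - Module.finrank K (commutant A) : ℕ) : WithBot ℕ∞) := by
  have hle (X : MatTuple K n m) : Module.finrank K (commutant X) ≤ n * n := by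
    simpa [Module.finrank_matrix] using (commutant X).finrank_le
  apply le_antisymm
  -- A chart is only available at the base point, so each `X` is made the base point of its own
  -- orbit. Quantifying over `hX` lets `orbit X` be rewritten to `orbit A` afterwards.
  · have key (X : MatTuple K n m) (hX : X ∈ orbit X) : ∃ U : Set (orbit X), IsOpen U ∧ ⟨X, hX⟩ ∈ U ∧
        topologicalKrullDim U ≤ ((n * n - Module.finrank K (commutant X) : ℕ) : WithBot ℕ∞) := by
      obtain ⟨D, U, D', φ, ψ, -, hU, hXU, -, -, hφ, -⟩ :=
        exists_chart X (Nat.sub_add_cancel (hle X))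
      refine ⟨U, hU, hXU, hφ.topologicalKrullDim_le.trans ((topologicalKrullDim_subspace_le _ D).trans
        (topologicalKrullDim_zariski_le.trans ?_))⟩
      simp
    refine topologicalKrullDim_le_of_forall_exists_isOpen fun X => ?_
    have := key X
    rw [finrank_commutant_eq X.2, orbit_eq_of_mem X.2] at this
    exact this X.2
  · obtain ⟨D, U, D', φ, ψ, hD, -, -, hD', hne, -, hψ⟩ :=
      exists_chart A (Nat.sub_add_cancel (hle A))
    have : Nonempty D' := hne.to_subtype
    exact (le_topologicalKrullDim_of_isOpenEmbedding
      (hD.isOpenEmbedding_subtypeVal.comp hD'.isOpenEmbedding_subtypeVal)).trans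
        (hψ.topologicalKrullDim_le.trans (topologicalKrullDim_subspace_le _ U))

end MatTuple

universe u

/-! ### Dimensions of Hom spaces and isomorphism of modules -/

section ModuleHom

/-- The dimension over `K` of the space of homomorphisms between two modules over a
`K`-algebra `R`. -/
noncomputable def homDim (K R : Type u) [Field K] [Ring R] [Algebra K R] (M N : Type u)
    [AddCommGroup M] [Module K M] [Module R M] [IsScalarTower K R M]
    [AddCommGroup N] [Module K N] [Module R N] [IsScalarTower K R N] : ℕ :=
  Module.finrank K (M →ₗ[R] N)

variable {K R : Type u} [Field K] [Ring R] [Algebra K R] {M N P M' N' : Type u}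
  [AddCommGroup M] [Module K M] [Module R M] [IsScalarTower K R M]
  [AddCommGroup N] [Module K N] [Module R N] [IsScalarTower K R N]
  [AddCommGroup P] [Module K P] [Module R P] [IsScalarTower K R P]
  [AddCommGroup M'] [Module K M'] [Module R M'] [IsScalarTower K R M']
  [AddCommGroup N'] [Module K N'] [Module R N'] [IsScalarTower K R N']

instance [FiniteDimensional K M] [FiniteDimensional K N] : FiniteDimensional K (M →ₗ[R] N) :=
  Module.Finite.of_injective (LinearMap.restrictScalarsₗ K R M N K)
    (LinearMap.restrictScalars_injective K)

instance (p : Submodule R M) [FiniteDimensional K M] : FiniteDimensional K p :=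
  Module.Finite.of_injective (p.subtype.restrictScalars K) Subtype.val_injective

/-- Precomposition with a homomorphism, as a `K`-linear map. -/
def precomp (K : Type u) [Field K] [Algebra K R] (P : Type u) [AddCommGroup P] [Module K P]
    [Module R P] [IsScalarTower K R P] [Module K M] [Module K N] [IsScalarTower K R M]
    [IsScalarTower K R N] (f : M →ₗ[R] N) : (N →ₗ[R] P) →ₗ[K] (M →ₗ[R] P) where
  toFun g := g ∘ₗ f
  map_add' _ _ := rfl
  map_smul' _ _ := rfl

theorem precomp_apply (f : M →ₗ[R] N) (g : N →ₗ[R] P) : precomp K P f g = g ∘ₗ f := rfl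

theorem homDim_congr_left (e : M ≃ₗ[R] M') : homDim K R M N = homDim K R M' N :=
  LinearEquiv.finrank_eq
    (LinearEquiv.ofLinearMap (precomp K N e.symm.toLinearMap) (precomp K N e.toLinearMap)
      (by ext; simp [precomp_apply]) (by ext; simp [precomp_apply]))

theorem homDim_congr_right (e : N ≃ₗ[R] N') : homDim K R M N = homDim K R M N' :=
  LinearEquiv.finrank_eq
    { toFun := fun f => e.toLinearMap ∘ₗ f
      map_add' := fun f g => by ext; simp
      map_smul' := fun r f => by
        ext x
        exact (e.toLinearMap.restrictScalars K).map_smul r (f x)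
      invFun := fun f => e.symm.toLinearMap ∘ₗ f
      left_inv := fun f => by ext; simp
      right_inv := fun f => by ext; simp }

theorem homDim_prod_left [FiniteDimensional K M] [FiniteDimensional K M'] [FiniteDimensional K N] :
    homDim K R (M × M') N = homDim K R M N + homDim K R M' N := by
  rw [homDim, ← (LinearMap.coprodEquiv (R := R) (M := M) (M₂ := M') (M₃ := N) K).finrank_eq,
    Module.finrank_prod]
  rfl

theorem homDim_prod_right [FiniteDimensional K M] [FiniteDimensional K N]
    [FiniteDimensional K N'] :
    homDim K R M (N × N') = homDim K R M N + homDim K R M N' := by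
  rw [homDim, ← (LinearMap.prodEquiv (R := R) (M := M) (M₂ := N) (M₃ := N') K).finrank_eq,
    Module.finrank_prod]
  rfl

theorem homDim_pi_left [FiniteDimensional K M] [FiniteDimensional K N] (r : ℕ) :
    homDim K R (Fin r → M) N = r * homDim K R M N := by
  rw [homDim, ← (LinearMap.lsum R (fun _ : Fin r => M) (M := N) K).finrank_eq,
    Module.finrank_pi_fintype]
  simp [homDim]

/-- Left exactness of Hom: maps out of the cokernel of `f` are the kernel of precomposition with
`f`, and rank–nullity does the rest. -/
theorem homDim_quotient_range [FiniteDimensional K M] [FiniteDimensional K N]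
    [FiniteDimensional K P] (f : M →ₗ[R] N) :
    homDim K R (N ⧸ f.range) P + Module.finrank K (precomp K P f).range = homDim K R N P := by
  have hinj : Function.Injective (precomp K P f.range.mkQ) := fun g g' h =>
    LinearMap.cancel_right f.range.mkQ_surjective |>.1 h
  have hker : (precomp K P f).ker = (precomp K P f.range.mkQ).range := by
    ext g
    rw [LinearMap.mem_ker, LinearMap.mem_range]
    constructor
    · intro hg
      refine ⟨f.range.liftQ g ?_, f.range.liftQ_mkQ g _⟩
      exact LinearMap.range_le_ker_iff.2 hg
    · rintro ⟨g, rfl⟩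
      ext x
      have hx : Submodule.Quotient.mk (p := f.range) (f x) = 0 :=
        (Submodule.Quotient.mk_eq_zero _).2 ⟨x, rfl⟩
      simp [precomp_apply, hx]
  have := LinearMap.finrank_range_add_finrank_ker (precomp K P f)
  rw [hker, LinearMap.finrank_range_of_inj hinj] at this
  rw [homDim, homDim, ← this, add_comm]

/-- If `Hom(X, M)` is never larger than `Hom(X, N)` and the relevant spaces of homomorphisms
have the same dimension, then `M` is a direct summand of a power of `N`. -/
theorem exists_sum_comp_eq_id [FiniteDimensional K M] [FiniteDimensional K N]
    (hle : ∀ (X : Type u) [AddCommGroup X] [Module K X] [Module R X] [IsScalarTower K R X]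
      [FiniteDimensional K X], homDim K R X M ≤ homDim K R X N)
    (h1 : homDim K R N N ≤ homDim K R N M) (h2 : homDim K R M M ≤ homDim K R M N) :
    ∃ (r : ℕ) (f : Fin r → M →ₗ[R] N) (g : Fin r → N →ₗ[R] M),
      ∑ i, g i ∘ₗ f i = LinearMap.id := by
  let b := Module.finBasis K (M →ₗ[R] N)
  -- The universal map from `M` to a power of `N`: its components form a basis of the homomorphisms,
  -- so every map from `M` to `N` factors through it.
  let F : M →ₗ[R] Fin (Module.finrank K (M →ₗ[R] N)) → N := LinearMap.pi fun i => b i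
  have hsurj : Function.Surjective (precomp K N F) := fun g => by
    refine ⟨∑ i, b.repr g i • LinearMap.proj i, ?_⟩
    conv_rhs => rw [← b.sum_repr g]
    ext x
    simp [precomp_apply, F]
  have hN := homDim_quotient_range (K := K) (P := N) F
  have hM := homDim_quotient_range (K := K) (P := M) F
  have hq := hle ((Fin (Module.finrank K (M →ₗ[R] N)) → N) ⧸ F.range)
  rw [LinearMap.range_eq_top.2 hsurj, finrank_top, homDim_pi_left] at hN
  rw [homDim_pi_left] at hM
  have hmul := Nat.mul_le_mul_left (Module.finrank K (M →ₗ[R] N)) h1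
  -- With `C` the cokernel of `F` and `r` the exponent, the rank is `r [N, M] - [C, M] ≥ r [N, N] -
  -- [C, N] = [M, N] ≥ [M, M]`. So the identity of `M` factors through `F`.
  have htop : (precomp K M F).range = ⊤ := by
    refine Submodule.eq_top_of_finrank_eq (le_antisymm (Submodule.finrank_le _) ?_)
    change homDim K R M M ≤ _
    change _ + homDim K R M N = _ at hN
    omega
  obtain ⟨G, hG⟩ := LinearMap.range_eq_top.1 htop LinearMap.id
  refine ⟨_, fun i => b i, fun i => G ∘ₗ LinearMap.single R (fun _ => N) i, ?_⟩
  rw [← hG, precomp_apply]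
  ext x
  simp only [LinearMap.coe_sum, Finset.sum_apply, LinearMap.comp_apply, ← map_sum]
  congr 1
  ext1 j
  simp [F, Finset.sum_apply, Pi.single_apply]

/-- If every element is a unit or nilpotent, a sum of elements that is a unit has a summand that
is a unit. -/
theorem exists_isUnit_of_isUnit_sum {S ι : Type*} [Ring S] [Nontrivial S]
    (h : ∀ x : S, IsUnit x ∨ IsNilpotent x) (s : Finset ι) (f : ι → S)
    (hs : IsUnit (∑ i ∈ s, f i)) : ∃ i ∈ s, IsUnit (f i) := by
  classical
  induction s using Finset.induction_on with
  | empty => simp at hs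
  | insert a s ha ih =>
    rw [Finset.sum_insert ha] at hs
    rcases h (f a) with hu | hn
    · exact ⟨a, Finset.mem_insert_self _ _, hu⟩
    obtain ⟨v, hv⟩ := hs
    -- A unit here would make the nilpotent `f a` a unit. The rest of the sum is then a unit times
    -- one minus a nilpotent.
    have hna : IsNilpotent (↑v⁻¹ * f a) := by
      refine (h _).resolve_left fun hu => ?_
      have : IsUnit (f a) := by simpa using v.isUnit.mul hu
      obtain ⟨k, hk⟩ := hn
      exact not_isUnit_zero (hk ▸ this.pow k)
    have h1 : (↑v⁻¹ : S) * ∑ i ∈ s, f i = 1 - ↑v⁻¹ * f a := by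
      rw [eq_sub_iff_add_eq, ← mul_add, add_comm, ← hv, Units.inv_mul]
    have h2 : IsUnit (∑ i ∈ s, f i) := by
      simpa using v.isUnit.mul (h1 ▸ hna.isUnit_one_sub : IsUnit ((↑v⁻¹ : S) * ∑ i ∈ s, f i))
    obtain ⟨i, hi, hu⟩ := ih h2
    exact ⟨i, Finset.mem_insert_of_mem hi, hu⟩

/-- A finite-dimensional nonzero module that is a direct summand of a power of `N` shares a
nonzero direct summand with `N`. -/
theorem exists_common_summand {K R : Type u} [Field K] [Ring R] [Algebra K R]
    {M N : Type u}
    [AddCommGroup M] [Module K M] [Module R M] [IsScalarTower K R M]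
    [AddCommGroup N] [Module K N] [Module R N] [IsScalarTower K R N]
    [FiniteDimensional K M] [Nontrivial M] {ι : Type*} (t : Finset ι)
    (f : ι → M →ₗ[R] N) (g : ι → N →ₗ[R] M) (h : ∑ i ∈ t, g i ∘ₗ f i = LinearMap.id) :
    ∃ (a : M →ₗ[R] N) (b : N →ₗ[R] M),
      a ≠ 0 ∧ a ∘ₗ b ∘ₗ a = a ∧ b ∘ₗ a ∘ₗ b = b := by
  by_cases hdec : ∀ e : Module.End R M, IsUnit e ∨ IsNilpotent e
  -- Here one summand of the identity is already invertible, and `M` itself is a summand of `N`.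
  · obtain ⟨i, -, hu⟩ := exists_isUnit_of_isUnit_sum hdec t (fun i => g i ∘ₗ f i)
      (h ▸ isUnit_one)
    obtain ⟨v, hv⟩ := hu
    have h1 : (((↑v⁻¹ : Module.End R M) ∘ₗ g i) ∘ₗ f i) = LinearMap.id := by
      rw [LinearMap.comp_assoc, ← hv]
      exact v.inv_mul
    refine ⟨f i, (↑v⁻¹ : Module.End R M) ∘ₗ g i, ?_, ?_, ?_⟩
    · intro h0
      rw [h0, LinearMap.comp_zero] at h1
      exact zero_ne_one (α := Module.End R M) h1
    · rw [h1, LinearMap.comp_id]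
    · rw [← LinearMap.comp_assoc, h1, LinearMap.id_comp]
  · push Not at hdec
    obtain ⟨e, he, hne⟩ := hdec
    have : IsNoetherian R M := isNoetherian_of_tower K inferInstance
    have : IsArtinian R M := isArtinian_of_tower K inferInstance
    -- Fitting's lemma: for large `k`, kernel and range of `e ^ k` are complementary. Both are
    -- nonzero, since `e` is neither nilpotent nor, as `k > 0`, invertible. The kernel is a smaller
    -- summand of `M` for the recursion.
    obtain ⟨k, hk, hpos⟩ := (e.eventually_isCompl_ker_pow_range_pow.and
      (Filter.eventually_gt_atTop 0)).exists
    have hr0 : (e ^ k).range ≠ ⊥ := fun h0 => hne ⟨k, LinearMap.range_eq_bot.1 h0⟩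
    have hk0 : (e ^ k).ker ≠ ⊥ := fun h0 => he <| by
      have htop := hk.codisjoint.eq_top
      rw [h0, bot_sup_eq] at htop
      have hu : IsUnit (e ^ k) := (Module.End.isUnit_iff _).2
        ⟨LinearMap.ker_eq_bot.1 h0, LinearMap.range_eq_top.1 htop⟩
      exact (isUnit_pow_iff hpos.ne').1 hu
    set Q := (e ^ k).ker
    have : Nontrivial Q := Submodule.nontrivial_iff_ne_bot.2 hk0
    have hlt : Module.finrank K Q < Module.finrank K M := by
      refine Submodule.finrank_lt (s := Q.restrictScalars K) fun htop => hr0 ?_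
      have hQ : Q = ⊤ := (Submodule.restrictScalars_eq_top_iff K R M).1 htop
      have := hk.disjoint.eq_bot
      rwa [hQ, top_inf_eq] at this
    let p := Submodule.projectionOnto _ _ hk
    have hp : p ∘ₗ Q.subtype = LinearMap.id := by
      ext x; simp [p]
    obtain ⟨a, b, ha, hab, hba⟩ := exists_common_summand (K := K) (M := Q) t
      (fun i => f i ∘ₗ Q.subtype) (fun i => p ∘ₗ g i) (by
        have := congr_arg (fun x => p ∘ₗ x ∘ₗ Q.subtype) h
        simp only [LinearMap.id_comp, hp] at this
        rw [← this]
        ext x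
        simp)
    refine ⟨a ∘ₗ p, Q.subtype ∘ₗ b, fun h0 => ha ?_, ?_, ?_⟩
    · rw [← LinearMap.comp_id a, ← hp, ← LinearMap.comp_assoc, h0, LinearMap.zero_comp]
    · ext x
      have := LinearMap.congr_fun hab (p x)
      have h2 (y) : p (Q.subtype y) = y := LinearMap.congr_fun hp y
      simp only [LinearMap.comp_apply] at this ⊢
      rw [h2, this]
    · ext x
      have := LinearMap.congr_fun hba x
      have h2 (y) : p (Q.subtype y) = y := LinearMap.congr_fun hp y
      simp only [LinearMap.comp_apply] at this ⊢
      rw [h2, this]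
termination_by Module.finrank K M

/-- Both `b ∘ₗ a` and `a ∘ₗ b` are idempotent, and `a`, `b` restrict to mutually inverse
isomorphisms between their ranges. The shared range splits off both modules, with the kernels as
complements. -/
theorem exists_prodEquiv_of_common_summand {a : M →ₗ[R] N} {b : N →ₗ[R] M}
    (hab : a ∘ₗ b ∘ₗ a = a) (hba : b ∘ₗ a ∘ₗ b = b) :
    Nonempty ((((b ∘ₗ a).range × (b ∘ₗ a).ker) ≃ₗ[R] M) ×
      (((b ∘ₗ a).range × (a ∘ₗ b).ker) ≃ₗ[R] N)) := by
  have h1 : IsIdempotentElem (b ∘ₗ a) := by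
    change (b ∘ₗ a) ∘ₗ b ∘ₗ a = b ∘ₗ a
    rw [LinearMap.comp_assoc, hab]
  have h2 : IsIdempotentElem (a ∘ₗ b) := by
    change (a ∘ₗ b) ∘ₗ a ∘ₗ b = a ∘ₗ b
    rw [LinearMap.comp_assoc, hba]
  have hab' (x) : a (b (a x)) = a x := LinearMap.congr_fun hab x
  have hba' (x) : b (a (b x)) = b x := LinearMap.congr_fun hba x
  let e : (b ∘ₗ a).range ≃ₗ[R] (a ∘ₗ b).range :=
    LinearEquiv.ofLinearMap
      (a.restrict (p := (b ∘ₗ a).range) (q := (a ∘ₗ b).range) (by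
        rintro _ ⟨x, rfl⟩; exact ⟨a x, by simp⟩))
      (b.restrict (p := (a ∘ₗ b).range) (q := (b ∘ₗ a).range) (by
        rintro _ ⟨x, rfl⟩; exact ⟨b x, by simp⟩))
      (by ext ⟨_, x, rfl⟩; simp [hab'])
      (by ext ⟨_, x, rfl⟩; simp [hba'])
  exact ⟨Submodule.prodEquivOfIsCompl _ _ (LinearMap.IsIdempotentElem.isCompl h1),
    (e.prodCongr (LinearEquiv.refl R _)).trans
      (Submodule.prodEquivOfIsCompl _ _ (LinearMap.IsIdempotentElem.isCompl h2))⟩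

/-- If `M` is below `N` in the hom order, the dimensions of `M` and `N` agree, and the
endomorphism ring of `N` is not larger than that of `M`, then `M` and `N` are isomorphic. -/
theorem nonempty_linearEquiv_of_homDim_le {K R : Type u} [Field K] [Ring R] [Algebra K R]
    {M N : Type u}
    [AddCommGroup M] [Module K M] [Module R M] [IsScalarTower K R M]
    [AddCommGroup N] [Module K N] [Module R N] [IsScalarTower K R N]
    [FiniteDimensional K M] [FiniteDimensional K N]
    (hl : ∀ (X : Type u) [AddCommGroup X] [Module K X] [Module R X] [IsScalarTower K R X]
      [FiniteDimensional K X], homDim K R X M ≤ homDim K R X N)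
    (hr : ∀ (X : Type u) [AddCommGroup X] [Module K X] [Module R X] [IsScalarTower K R X]
      [FiniteDimensional K X], homDim K R M X ≤ homDim K R N X)
    (hend : homDim K R N N ≤ homDim K R M M)
    (hdim : Module.finrank K M = Module.finrank K N) : Nonempty (M ≃ₗ[R] N) := by
  rcases subsingleton_or_nontrivial M with hM | hM
  · have : Subsingleton N := Module.finrank_zero_iff.1
      (hdim.symm.trans (Module.finrank_zero_iff.2 hM))
    exact ⟨LinearEquiv.ofSubsingleton M N⟩
  obtain ⟨r, f, g, hfg⟩ := exists_sum_comp_eq_id hl ((hend.trans (hr M)))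
    (by have := hl N; have := hr N; have := hl M; have := hr M; omega)
  obtain ⟨a, b, ha, hab, hba⟩ := exists_common_summand (K := K) Finset.univ f g hfg
  obtain ⟨eM, eN⟩ := exists_prodEquiv_of_common_summand hab hba
  set Z := (b ∘ₗ a).range
  set P := (b ∘ₗ a).ker
  set Q := (a ∘ₗ b).ker
  have hZ : Nontrivial Z := Submodule.nontrivial_iff_ne_bot.2 fun h0 => ha <| by
    rw [← hab, LinearMap.range_eq_bot.1 h0, LinearMap.comp_zero]
  have hfM : Module.finrank K Z + Module.finrank K P = Module.finrank K M := by
    rw [← Module.finrank_prod, (eM.restrictScalars K).finrank_eq]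
  have hfN : Module.finrank K Z + Module.finrank K Q = Module.finrank K N := by
    rw [← Module.finrank_prod, (eN.restrictScalars K).finrank_eq]
  have hpos : 0 < Module.finrank K Z := Module.finrank_pos
  -- The hypotheses pass to the complements because Hom dimensions are additive and the contribution
  -- of `Z` cancels.
  have dl (X : Type u) [AddCommGroup X] [Module K X] [Module R X] [IsScalarTower K R X]
      [FiniteDimensional K X] : homDim K R X P ≤ homDim K R X Q := by
    have := hl X
    rw [← homDim_congr_right eM, ← homDim_congr_right eN, homDim_prod_right,
      homDim_prod_right] at this
    omega
  have dr (X : Type u) [AddCommGroup X] [Module K X] [Module R X] [IsScalarTower K R X]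
      [FiniteDimensional K X] : homDim K R P X ≤ homDim K R Q X := by
    have := hr X
    rw [← homDim_congr_left eM, ← homDim_congr_left eN, homDim_prod_left,
      homDim_prod_left] at this
    omega
  -- Expanding both endomorphism dimensions, `[Z, Z]` cancels, while `[Z, P] ≤ [Z, Q]` and `[P, Z] ≤
  -- [Q, Z]` absorb the mixed terms.
  have hend' : homDim K R Q Q ≤ homDim K R P P := by
    rw [← homDim_congr_left eM, ← homDim_congr_left eN, ← homDim_congr_right eM,
      ← homDim_congr_right eN] at hend
    simp only [homDim_prod_left, homDim_prod_right] at hend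
    have := dl Z
    have := dr Z
    omega
  have : Module.finrank K P < Module.finrank K M := by omega
  obtain ⟨e⟩ := nonempty_linearEquiv_of_homDim_le (K := K) (M := P) (N := Q) dl dr hend' (by omega)
  exact ⟨eM.symm.trans (((LinearEquiv.refl R Z).prodCongr e).trans eN)⟩
termination_by Module.finrank K M

end ModuleHom

/-! ### Matrix tuples as modules over the free algebra -/

namespace MatTuple

variable {K : Type u} [Field K] {n m : ℕ}

/-- The space `K ^ n`, on which the free algebra acts through the tuple `A`. -/
def TupleModule (_ : MatTuple K n m) : Type u := Fin n → K

section TupleModule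

variable (A : MatTuple K n m)

instance : AddCommGroup (TupleModule A) := inferInstanceAs (AddCommGroup (Fin n → K))

instance : Module K (TupleModule A) := inferInstanceAs (Module K (Fin n → K))

instance : FiniteDimensional K (TupleModule A) :=
  inferInstanceAs (FiniteDimensional K (Fin n → K))

/-- The vector in `TupleModule A` with given coordinates. -/
def toTupleModule : (Fin n → K) ≃ₗ[K] TupleModule A := LinearEquiv.refl K _

noncomputable instance : Module (FreeAlgebra K (Fin m)) (TupleModule A) :=
  Module.compHom (Fin n → K)
    ((Matrix.toLinAlgEquiv' : Matrix (Fin n) (Fin n) K ≃ₐ[K] _).toAlgHom.comp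
      (FreeAlgebra.lift K A)).toRingHom

variable {A}

theorem smul_toTupleModule (x : FreeAlgebra K (Fin m)) (v : Fin n → K) :
    x • toTupleModule A v = toTupleModule A ((FreeAlgebra.lift K A x).mulVec v) :=
  rfl

theorem ι_smul_toTupleModule (i : Fin m) (v : Fin n → K) :
    FreeAlgebra.ι K i • toTupleModule A v = toTupleModule A ((A i).mulVec v) := by
  rw [smul_toTupleModule, FreeAlgebra.lift_ι_apply]

instance : IsScalarTower K (FreeAlgebra K (Fin m)) (TupleModule A) where
  smul_assoc r x v := by
    obtain ⟨v, rfl⟩ := (toTupleModule A).surjective v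
    rw [smul_toTupleModule, smul_toTupleModule, map_smul, Matrix.smul_mulVec, map_smul]

theorem finrank_tupleModule : Module.finrank K (TupleModule A) = n := by
  rw [← (toTupleModule A).finrank_eq]; simp

end TupleModule

/-- A `K`-linear map that commutes with the generators of the free algebra is a homomorphism of
modules over the free algebra. -/
def homOfCommute {M N : Type u}
    [AddCommGroup M] [Module K M] [Module (FreeAlgebra K (Fin m)) M]
    [IsScalarTower K (FreeAlgebra K (Fin m)) M]
    [AddCommGroup N] [Module K N] [Module (FreeAlgebra K (Fin m)) N]
    [IsScalarTower K (FreeAlgebra K (Fin m)) N] (f : M →ₗ[K] N)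
    (hf : ∀ (i : Fin m) (v : M), f (FreeAlgebra.ι K i • v) = FreeAlgebra.ι K i • f v) :
    M →ₗ[FreeAlgebra K (Fin m)] N where
  toFun := f
  map_add' := map_add f
  map_smul' x := by
    induction x using FreeAlgebra.induction with
    | grade0 r => intro v; simp
    | grade1 i => exact hf i
    | mul a b ha hb => intro v; simp only [RingHom.id_apply] at *; rw [mul_smul, ha, hb, mul_smul]
    | add a b ha hb =>
      intro v
      simp only [RingHom.id_apply] at * 
      rw [add_smul, map_add, ha, hb, add_smul]

/-! ### Hom spaces as kernels of evaluated polynomial matrices -/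

variable {X : Type u} [AddCommGroup X] [Module K X] [Module (FreeAlgebra K (Fin m)) X] {q : ℕ}

/-- The matrix of polynomials whose kernel on `K ^ n` is the space of homomorphisms from `X` to
`K ^ n`. -/
noncomputable def sourceMatrix (b : Module.Basis (Fin q) K X) :
    Matrix (Fin (m * q)) (Fin q) (FreeAlgebra K (Fin m)) :=
  Matrix.of fun p k =>
    (if k = (finProdFinEquiv.symm p).2 then FreeAlgebra.ι K (finProdFinEquiv.symm p).1 else 0) -
      algebraMap K _ (b.repr (FreeAlgebra.ι K (finProdFinEquiv.symm p).1 •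
        b (finProdFinEquiv.symm p).2) k)

/-- The matrix of polynomials whose left kernel on `K ^ n` is the space of homomorphisms from
`K ^ n` to `X`. -/
noncomputable def targetMatrix (b : Module.Basis (Fin q) K X) :
    Matrix (Fin q) (Fin (m * q)) (FreeAlgebra K (Fin m)) :=
  Matrix.of fun k p =>
    (if k = (finProdFinEquiv.symm p).2 then FreeAlgebra.ι K (finProdFinEquiv.symm p).1 else 0) -
      algebraMap K _ (b.repr (FreeAlgebra.ι K (finProdFinEquiv.symm p).1 •
        b k) (finProdFinEquiv.symm p).2)

theorem evalMatrix_mulVec {k l : ℕ} (φ : Matrix (Fin k) (Fin l) (FreeAlgebra K (Fin m)))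
    (A : MatTuple K n m) (u : Fin l × Fin n → K) (p : Fin k) (a : Fin n) :
    (evalMatrix φ A).mulVec u (p, a) =
      ∑ j, (FreeAlgebra.lift K A (φ p j)).mulVec (fun c => u (j, c)) a := by
  simp [Matrix.mulVec, dotProduct, Fintype.sum_prod_type, evalMatrix]

theorem evalMatrix_transpose_mulVec {k l : ℕ}
    (φ : Matrix (Fin k) (Fin l) (FreeAlgebra K (Fin m)))
    (A : MatTuple K n m) (u : Fin k × Fin n → K) (p : Fin l) (a : Fin n) :
    (evalMatrix φ A).transpose.mulVec u (p, a) =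
      ∑ j, (FreeAlgebra.lift K A (φ j p)).transpose.mulVec (fun c => u (j, c)) a := by
  simp [Matrix.mulVec, dotProduct, Fintype.sum_prod_type, evalMatrix]

theorem evalMatrix_sourceMatrix_mulVec (b : Module.Basis (Fin q) K X) (A : MatTuple K n m)
    (u : Fin q × Fin n → K) (i : Fin m) (j : Fin q) (a : Fin n) :
    (evalMatrix (sourceMatrix b) A).mulVec u (finProdFinEquiv (i, j), a) =
      (A i).mulVec (fun c => u (j, c)) a -
        ∑ k, b.repr (FreeAlgebra.ι K i • b j) k * u (k, a) := by
  rw [evalMatrix_mulVec]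
  simp only [sourceMatrix, Matrix.of_apply, Equiv.symm_apply_apply, map_sub, Matrix.sub_mulVec,
    Pi.sub_apply, Finset.sum_sub_distrib, AlgHom.commutes]
  congr 1
  · rw [Finset.sum_eq_single j]
    · simp
    · intro k _ hk
      simp [hk]
    · simp
  · simp [Algebra.algebraMap_eq_smul_one, Matrix.smul_mulVec]

theorem evalMatrix_targetMatrix_transpose_mulVec (b : Module.Basis (Fin q) K X)
    (A : MatTuple K n m) (u : Fin q × Fin n → K) (i : Fin m) (j : Fin q) (a : Fin n) :
    (evalMatrix (targetMatrix b) A).transpose.mulVec u (finProdFinEquiv (i, j), a) =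
      (A i).transpose.mulVec (fun c => u (j, c)) a -
        ∑ k, b.repr (FreeAlgebra.ι K i • b k) j * u (k, a) := by
  rw [evalMatrix_transpose_mulVec]
  simp only [targetMatrix, Matrix.of_apply, Equiv.symm_apply_apply, map_sub, Matrix.transpose_sub,
    Matrix.sub_mulVec, Pi.sub_apply, Finset.sum_sub_distrib, AlgHom.commutes]
  congr 1
  · rw [Finset.sum_eq_single j]
    · simp
    · intro k _ hk
      simp [hk]
    · simp
  · simp [Algebra.algebraMap_eq_smul_one, Matrix.smul_mulVec]

variable [IsScalarTower K (FreeAlgebra K (Fin m)) X]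

/-- A linear map from `X` is a choice of `q` vectors, the images of the basis. Row block `(i, j)` of
the system expresses that the map commutes with generator `i` on basis vector `j`; commuting with
the generators is enough. -/
theorem homDim_add_rank_sourceMatrix (b : Module.Basis (Fin q) K X) (A : MatTuple K n m) :
    homDim K (FreeAlgebra K (Fin m)) X (TupleModule A) + (evalMatrix (sourceMatrix b) A).rank =
      q * n := by
  let Φ : (X →ₗ[FreeAlgebra K (Fin m)] TupleModule A) →ₗ[K] (Fin q × Fin n → K) :=
    { toFun := fun f p => (toTupleModule A).symm (f (b p.1)) p.2
      map_add' := fun f g => by ext; simp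
      map_smul' := fun r f => by ext; simp }
  have hinj : Function.Injective Φ := fun f g h => by
    have : f.restrictScalars K = g.restrictScalars K := b.ext fun j => by
      apply (toTupleModule A).symm.injective
      ext a
      exact congr_fun h (j, a)
    ext x
    exact LinearMap.congr_fun this x
  have hrange : Φ.range = (evalMatrix (sourceMatrix b) A).mulVecLin.ker := by
    ext u
    have key (f : X →ₗ[K] TupleModule A)
        (hf : ∀ j, f (b j) = toTupleModule A fun c => u (j, c)) (i : Fin m) (j : Fin q) :
        f (FreeAlgebra.ι K i • b j) = FreeAlgebra.ι K i • f (b j) ↔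
          ∀ a, (evalMatrix (sourceMatrix b) A).mulVec u (finProdFinEquiv (i, j), a) = 0 := by
      have h1 : f (FreeAlgebra.ι K i • b j) = toTupleModule A
          fun a => ∑ k, b.repr (FreeAlgebra.ι K i • b j) k * u (k, a) := by
        conv_lhs => rw [← b.sum_repr (FreeAlgebra.ι K i • b j), map_sum]
        simp only [map_smul, hf]
        simp only [← map_smul, ← map_sum]
        congr 1
        ext a
        simp
      rw [h1, hf, ι_smul_toTupleModule, (toTupleModule A).injective.eq_iff, funext_iff]
      refine forall_congr' fun a => ?_
      rw [evalMatrix_sourceMatrix_mulVec, sub_eq_zero, eq_comm]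
    rw [LinearMap.mem_range, LinearMap.mem_ker, Matrix.mulVecLin_apply]
    constructor
    · rintro ⟨f, rfl⟩
      ext ⟨p, a⟩
      obtain ⟨⟨i, j⟩, rfl⟩ := finProdFinEquiv.surjective p
      exact (key (f.restrictScalars K) (fun j => rfl) i j).1 (f.map_smul _ _) a
    · intro hu
      let f : X →ₗ[K] TupleModule A := b.constr K fun j => toTupleModule A fun c => u (j, c)
      have hf (j) : f (b j) = toTupleModule A fun c => u (j, c) := b.constr_basis K _ j
      refine ⟨homOfCommute f fun i v => ?_, ?_⟩
      · have : f ∘ₗ Algebra.lsmul K K X (FreeAlgebra.ι K i) =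
            Algebra.lsmul K K (TupleModule A) (FreeAlgebra.ι K i) ∘ₗ f :=
          b.ext fun j => (key f hf i j).2 fun a => by rw [hu]; rfl
        exact LinearMap.congr_fun this v
      · ext ⟨j, a⟩
        change (toTupleModule A).symm (f (b j)) a = _
        rw [hf, LinearEquiv.symm_apply_apply]
  have := LinearMap.finrank_range_add_finrank_ker (evalMatrix (sourceMatrix b) A).mulVecLin
  rw [← hrange, LinearMap.finrank_range_of_inj hinj] at this
  rw [homDim, Matrix.rank, add_comm, this]
  simp

/-- A linear map to `X` is recorded by the coordinates of the images of the standard basis. The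
action on the source appears through the transposes of the `A i`, so Hom is the kernel of the
transposed matrix, which has the same rank. -/
theorem homDim_add_rank_targetMatrix (b : Module.Basis (Fin q) K X) (A : MatTuple K n m) :
    homDim K (FreeAlgebra K (Fin m)) (TupleModule A) X + (evalMatrix (targetMatrix b) A).rank =
      q * n := by
  let ε : Module.Basis (Fin n) K (TupleModule A) := Module.Basis.ofEquivFun (toTupleModule A).symm
  have hε (v : Fin n → K) : toTupleModule A v = ∑ c, v c • ε c := by
    rw [← ε.sum_repr (toTupleModule A v)]
    simp [ε]
  let Φ : (TupleModule A →ₗ[FreeAlgebra K (Fin m)] X) →ₗ[K] (Fin q × Fin n → K) :=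
    { toFun := fun f p => b.repr (f (ε p.2)) p.1
      map_add' := fun f g => by ext; simp
      map_smul' := fun r f => by ext; simp }
  have hinj : Function.Injective Φ := fun f g h => by
    have : f.restrictScalars K = g.restrictScalars K := ε.ext fun c => by
      apply b.repr.injective
      ext j
      exact congr_fun h (j, c)
    ext x
    exact LinearMap.congr_fun this x
  have hrange : Φ.range = (evalMatrix (targetMatrix b) A).transpose.mulVecLin.ker := by
    ext u
    have key (f : TupleModule A →ₗ[K] X)
        (hf : ∀ c j, b.repr (f (ε c)) j = u (j, c)) (i : Fin m) (a : Fin n) :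
        f (FreeAlgebra.ι K i • ε a) = FreeAlgebra.ι K i • f (ε a) ↔
          ∀ j, (evalMatrix (targetMatrix b) A).transpose.mulVec u
            (finProdFinEquiv (i, j), a) = 0 := by
      have h1 : FreeAlgebra.ι K i • ε a = toTupleModule A fun c => A i c a := by
        rw [show ε a = toTupleModule A (Pi.single a 1) by simp [ε, Pi.single]]
        rw [ι_smul_toTupleModule, Matrix.mulVec_single_one]
        rfl
      have h2 (j) : b.repr (FreeAlgebra.ι K i • f (ε a)) j =
          ∑ k, b.repr (FreeAlgebra.ι K i • b k) j * u (k, a) := by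
        conv_lhs => rw [← b.sum_repr (f (ε a)), Finset.smul_sum, map_sum]
        simp only [smul_comm (FreeAlgebra.ι K i), map_smul, hf, Finsupp.finsetSum_apply,
          Finsupp.smul_apply, smul_eq_mul]
        exact Finset.sum_congr rfl fun k _ => mul_comm _ _
      rw [h1, hε, map_sum, ← b.repr.injective.eq_iff, Finsupp.ext_iff]
      refine forall_congr' fun j => ?_
      rw [h2, evalMatrix_targetMatrix_transpose_mulVec, sub_eq_zero]
      simp [hf, Matrix.mulVec, dotProduct]
    rw [LinearMap.mem_range, LinearMap.mem_ker, Matrix.mulVecLin_apply]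
    constructor
    · rintro ⟨f, rfl⟩
      ext ⟨p, a⟩
      obtain ⟨⟨i, j⟩, rfl⟩ := finProdFinEquiv.surjective p
      exact (key (f.restrictScalars K) (fun _ _ => rfl) i a).1 (f.map_smul _ _) j
    · intro hu
      let f : TupleModule A →ₗ[K] X := ε.constr K fun c => ∑ j, u (j, c) • b j
      have hf (c j) : b.repr (f (ε c)) j = u (j, c) := by
        rw [ε.constr_basis, b.repr_sum_self]
      refine ⟨homOfCommute f fun i v => ?_, ?_⟩
      · have : f ∘ₗ Algebra.lsmul K K (TupleModule A) (FreeAlgebra.ι K i) =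
            Algebra.lsmul K K X (FreeAlgebra.ι K i) ∘ₗ f :=
          ε.ext fun a => (key f hf i a).2 fun j => by rw [hu]; rfl
        exact LinearMap.congr_fun this v
      · ext ⟨j, c⟩
        exact hf c j
  have := LinearMap.finrank_range_add_finrank_ker
    (evalMatrix (targetMatrix b) A).transpose.mulVecLin
  rw [← hrange, LinearMap.finrank_range_of_inj hinj] at this
  rw [homDim, ← Matrix.rank_transpose, Matrix.rank, add_comm, this]
  simp

theorem HomLE.homDim_le_right {A B : MatTuple K n m} (h : HomLE A B) [FiniteDimensional K X] :
    homDim K (FreeAlgebra K (Fin m)) X (TupleModule A) ≤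
      homDim K (FreeAlgebra K (Fin m)) X (TupleModule B) := by
  let b := Module.finBasis K X
  have h1 := homDim_add_rank_sourceMatrix b A
  have h2 := homDim_add_rank_sourceMatrix b B
  have := h _ _ (sourceMatrix b)
  omega

theorem HomLE.homDim_le_left {A B : MatTuple K n m} (h : HomLE A B) [FiniteDimensional K X] :
    homDim K (FreeAlgebra K (Fin m)) (TupleModule A) X ≤
      homDim K (FreeAlgebra K (Fin m)) (TupleModule B) X := by
  let b := Module.finBasis K X
  have h1 := homDim_add_rank_targetMatrix b A
  have h2 := homDim_add_rank_targetMatrix b B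
  have := h _ _ (targetMatrix b)
  omega

/-! ### Module homomorphisms as intertwining matrices -/

/-- The matrix of a homomorphism between modules defined by tuples. -/
noncomputable def homToMatrix (A B : MatTuple K n m) :
    (TupleModule A →ₗ[FreeAlgebra K (Fin m)] TupleModule B) →ₗ[K] Matrix (Fin n) (Fin n) K where
  toFun f := LinearMap.toMatrix'
    ((toTupleModule B).symm.toLinearMap ∘ₗ f.restrictScalars K ∘ₗ (toTupleModule A).toLinearMap)
  map_add' f g := by
    rw [← map_add]
    congr 1
  map_smul' r f := by
    rw [RingHom.id_apply, ← map_smul]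
    congr 1

theorem homToMatrix_mulVec {A B : MatTuple K n m}
    (f : TupleModule A →ₗ[FreeAlgebra K (Fin m)] TupleModule B) (v : Fin n → K) :
    toTupleModule B ((homToMatrix A B f).mulVec v) = f (toTupleModule A v) := by
  rw [homToMatrix]
  simp [LinearMap.toMatrix'_mulVec]

theorem matrix_eq_of_mulVec_eq {M N : Matrix (Fin n) (Fin n) K}
    (h : ∀ v, M.mulVec v = N.mulVec v) : M = N :=
  Matrix.toLin'.injective (LinearMap.ext h)

theorem homToMatrix_injective (A B : MatTuple K n m) : Function.Injective (homToMatrix A B) := by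
  intro f g h
  ext x
  obtain ⟨v, rfl⟩ := (toTupleModule A).surjective x
  rw [← homToMatrix_mulVec, h, homToMatrix_mulVec]

theorem range_homToMatrix (A B : MatTuple K n m) :
    (homToMatrix A B).range = (intertwiner B A).ker := by
  ext M
  rw [LinearMap.mem_range, mem_ker_intertwiner]
  constructor
  · rintro ⟨f, rfl⟩ i
    refine matrix_eq_of_mulVec_eq fun v => (toTupleModule B).injective ?_
    rw [← Matrix.mulVec_mulVec, ← Matrix.mulVec_mulVec, homToMatrix_mulVec,
      ← ι_smul_toTupleModule, ← ι_smul_toTupleModule, homToMatrix_mulVec, map_smul]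
  · intro hM
    refine ⟨homOfCommute ((toTupleModule B).toLinearMap ∘ₗ M.mulVecLin ∘ₗ
      (toTupleModule A).symm.toLinearMap) fun i x => ?_,
      matrix_eq_of_mulVec_eq fun v => (toTupleModule B).injective ?_⟩
    · obtain ⟨v, rfl⟩ := (toTupleModule A).surjective x
      rw [ι_smul_toTupleModule]
      simp only [LinearMap.comp_apply, LinearEquiv.coe_coe, LinearEquiv.symm_apply_apply,
        Matrix.mulVecLin_apply, ι_smul_toTupleModule, Matrix.mulVec_mulVec, hM i]
    · rw [homToMatrix_mulVec]
      rfl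

/-- The link between the two halves: the endomorphism dimension of the module is the number that
determines the orbit dimension. -/
theorem homDim_tupleModule_self (A : MatTuple K n m) :
    homDim K (FreeAlgebra K (Fin m)) (TupleModule A) (TupleModule A) =
      Module.finrank K (commutant A) := by
  rw [homDim, ← LinearMap.finrank_range_of_inj (homToMatrix_injective A A), range_homToMatrix]
  rfl

theorem mem_orbit_of_linearEquiv {A B : MatTuple K n m}
    (e : TupleModule A ≃ₗ[FreeAlgebra K (Fin m)] TupleModule B) : B ∈ orbit A := by
  refine mem_orbit_iff.2 ⟨homToMatrix A B e.toLinearMap, ?_, ?_⟩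
  · have : homToMatrix B A e.symm.toLinearMap * homToMatrix A B e.toLinearMap = 1 :=
      matrix_eq_of_mulVec_eq fun v => (toTupleModule A).injective (by
        rw [← Matrix.mulVec_mulVec, homToMatrix_mulVec, homToMatrix_mulVec, Matrix.one_mulVec]
        exact e.symm_apply_apply _)
    exact Matrix.det_ne_zero_of_left_inverse this
  · have h := LinearMap.mem_range_self (homToMatrix A B) e.toLinearMap
    rw [range_homToMatrix] at h
    exact mem_ker_intertwiner.1 h

end MatTuple

theorem lemma2p2 {K : Type*} [Field K] [IsAlgClosed K] (n m : ℕ) (A B : MatTuple K n m)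
    (h : MatTuple.HomLT A B) : MatTuple.orbitDim B < MatTuple.orbitDim A := by
  have : Infinite K := IsAlgClosed.instInfinite
  obtain ⟨hle, hne⟩ := h
  have hlt : Module.finrank K (MatTuple.commutant A) < Module.finrank K (MatTuple.commutant B) := by
    rw [← MatTuple.homDim_tupleModule_self, ← MatTuple.homDim_tupleModule_self]
    -- Otherwise the modules are isomorphic, and an isomorphism is a conjugating matrix, so the
    -- orbits coincide.
    by_contra! hge
    obtain ⟨e⟩ := nonempty_linearEquiv_of_homDim_le (fun X => hle.homDim_le_right)
      (fun X => hle.homDim_le_left) hge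
      (by rw [MatTuple.finrank_tupleModule, MatTuple.finrank_tupleModule])
    exact hne (MatTuple.orbit_eq_of_mem (MatTuple.mem_orbit_of_linearEquiv e)).symm
  -- This bound keeps the truncated subtraction in `orbitDim_eq` strictly decreasing between the two
  -- commutant dimensions.
  have hB : Module.finrank K (MatTuple.commutant B) ≤ n * n := by
    simpa [Module.finrank_matrix] using (MatTuple.commutant B).finrank_le
  rw [MatTuple.orbitDim_eq, MatTuple.orbitDim_eq]
  norm_cast
  omega
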